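/- A convex combination (CC) space is a metric space $(\mathfrak X,d)$ with an operation assigning to all points $x_1,\dots,x_n$ and weights $\lambda_1,\dots,\lambda_n>0$ with $\sum_i\lambda_i=1$ a point $[\lambda_i,x_i]_{i=1}^n$, such that $[1,x]=x$ and: (i) it is invariant under simultaneous permutation of weights and points; (ii) $[\lambda_i,x_i]_{i=1}^{n+2}=\big[\lambda_1,x_1;\dots;\lambda_n,x_n;\lambda_{n+1}+\lambda_{n+2},\big[\tfrac{\lambda_{n+j}}{\lambda_{n+1}+\lambda_{n+2}},x_{n+j}\big]_{j=1}^2\big]$; (iii) $\lambda\mapsto[\lambda,x;1-\lambda,y]$ is continuous on $(0,1)$; (iv) $d([\lambda,x_1;1-\lambda,x_2],[\lambda,y_1;1-\lambda,y_2])\le\lambda d(x_1,y_1)+(1-\lambda)d(x_2,y_2)$ for $\lambda\in(0,1)$; (v) $Kx:=\lim_n[n^{-1},x]_{i=1}^n$ exists for every $x$. Put $K(\mathfrak X)=\{Kx:x\in\mathfrak X\}$. Let $\mathfrak X$ be a complete separable CC space, $(\Omega,\mathcal F,P)$ a probability space and $\mathcal G\subset\mathcal F$ a sub-$\sigma$-algebra.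 A Borel measurable $X:\Omega\to\mathfrak X$ is integrable if $\mathbb E\,d(a,X)<\infty$ for some $a\in\mathfrak X$. If $X$ takes only the values $x_1,\dots,x_m$ (distinct), put $E(X|\mathcal G)=[P(X=x_i|\mathcal G),Kx_i]_{i=1}^m$ a.s., terms of weight $0$ being omitted. Fix $u_0\in K(\mathfrak X)$ and a dense sequence $(u_j)_{j\ge1}$ in $\mathfrak X$, and let $\psi_n(x)$ be the point among $u_0,\dots,u_n$ nearest to $x$ (the one of least index in case of ties). For integrable $X$, $E(X|\mathcal G)$ is the $\mathcal G$-measurable random element, unique up to a null set, with $E(X|\mathcal G)=\lim_{n\to\infty}E(\psi_n(X)|\mathcal G)$ a.s. **Theorem 4.8.** Let $X$ be an integrable $\mathfrak X$-valued random element. Then $E(X|\mathcal G)$ and $E(KX|\mathcal G)$ exist. There are a separable Banach space $\mathbb E$ and a map $j:K(\mathfrak X)\to\mathbb E$ with closed convex image such that $\|j(x)-j(y)\|=d(x,y)$ and $j([\lambda,x;1-\lambda,y])=\lambda j(x)+(1-\lambda)j(y)$ for all $x,y\in K(\mathfrak X)$, $\lambda\in(0,1)$. For every real Banach space $\mathbb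 E$ and every map $j:K(\mathfrak X)\to\mathbb E$ with these two identities, $j(KX)$ is Bochner integrable, $E(X|\mathcal G)$ and $E(KX|\mathcal G)$ lie in $K(\mathfrak X)$ a.s., and $$j(E(X|\mathcal G))=j(E(KX|\mathcal G))=E(j(KX)|\mathcal G)\quad\text{a.s.,}$$ where the right-hand side is the conditional expectation of the Banach-valued random element $j(KX)$. -/

import Mathlib

open MeasureTheory Filter Topology

universe u v w

/-- A convex combination space: a metric space with an operation `[lam 1, x 1; …; lam n, x n]`,
written `comb lam x`, on tuples of points with positive weights that sum to one. The values of `comb`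
at all other weights are irrelevant: no axiom mentions them. -/
class ConvexCombSpace (S : Type u) [MetricSpace S] where
  comb : ∀ {n : ℕ}, (Fin n → ℝ) → (Fin n → S) → S
  /-- `[1, x] = x` -/
  comb_one : ∀ x : S, comb (fun _ : Fin 1 => (1 : ℝ)) (fun _ => x) = x
  /-- Commutativity. -/
  comb_perm : ∀ {n : ℕ} (lam : Fin n → ℝ) (x : Fin n → S),
    (∀ i, 0 < lam i) → ∑ i, lam i = 1 → ∀ σ : Equiv.Perm (Fin n),
      comb lam x = comb (fun i => lam (σ i)) (fun i => x (σ i))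
  /-- Associativity: the last two of `n + 2` terms are grouped together. -/
  comb_assoc : ∀ {n : ℕ} (lam : Fin n → ℝ) (x : Fin n → S) (a b : ℝ) (y z : S),
    (∀ i, 0 < lam i) → 0 < a → 0 < b → ∑ i, lam i + a + b = 1 →
      comb (Fin.snoc (Fin.snoc lam a : Fin (n + 1) → ℝ) b : Fin (n + 2) → ℝ)
          (Fin.snoc (Fin.snoc x y : Fin (n + 1) → S) z : Fin (n + 2) → S) =
        comb (Fin.snoc lam (a + b) : Fin (n + 1) → ℝ)
          (Fin.snoc x (comb ![a / (a + b), b / (a + b)] ![y, z]) : Fin (n + 1) → S)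
  /-- Continuity in the weight. -/
  comb_continuous : ∀ x y : S,
    ContinuousOn (fun t : ℝ => comb ![t, 1 - t] ![x, y]) (Set.Ioo 0 1)
  /-- Negative curvature. -/
  dist_comb_le : ∀ (t : ℝ) (x₁ x₂ y₁ y₂ : S), 0 < t → t < 1 →
    dist (comb ![t, 1 - t] ![x₁, x₂]) (comb ![t, 1 - t] ![y₁, y₂]) ≤
      t * dist x₁ y₁ + (1 - t) * dist x₂ y₂
  /-- Convexification: `[1/n, x; …; 1/n, x]` converges. -/
  exists_convexification : ∀ x : S, ∃ y : S,
    Tendsto (fun n : ℕ => comb (fun _ : Fin n => (n : ℝ)⁻¹) (fun _ => x)) atTop (𝓝 y)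

namespace ConvexCombSpace

noncomputable section

section Space

variable {S : Type u} [MetricSpace S] [ConvexCombSpace S]

/-- The convexification operator `K x = lim [1/n, x; …; 1/n, x]`. -/
def convexify (x : S) : S := Classical.choose (exists_convexification x)

theorem tendsto_convexify (x : S) :
    Tendsto (fun n : ℕ => comb (fun _ : Fin n => (n : ℝ)⁻¹) (fun _ => x)) atTop
      (𝓝 (convexify x)) :=
  Classical.choose_spec (exists_convexification x)

variable (S) in
/-- The convexifiable domain `K(S)`. -/
def convexDomain : Set S := Set.range (convexify : S → S)

/-- `K` as a map from `S` onto the convexifiable domain. -/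
def toDomain (x : S) : convexDomain S := ⟨convexify x, Set.mem_range_self x⟩

/-- The combination `[lam i, x i]` over a finite set of indices with nonnegative weights that sum
to one: the terms of weight zero are dropped. By commutativity the enumeration of the remaining
terms does not matter. -/
def combOn {ι : Type v} (s : Finset ι) (lam : ι → ℝ) (x : ι → S) : S :=
  comb (fun k => lam ((s.filter fun i => 0 < lam i).equivFin.symm k))
    (fun k => x ((s.filter fun i => 0 < lam i).equivFin.symm k))

/-- `j` is an isometric embedding of the convexifiable domain into a normed space that carries
convex combinations to convex combinations. (For the weights `0` and `1`, where the combination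
of `x` and `y` is `y` and `x`, the second condition is trivial.) -/
structure IsConvexEmbedding {E : Type v} [NormedAddCommGroup E] [NormedSpace ℝ E]
    (j : convexDomain S → E) : Prop where
  isometry : ∀ x y : convexDomain S, dist (x : S) (y : S) = ‖j x - j y‖
  affine : ∀ (x y : convexDomain S) (t : ℝ), 0 < t → t < 1 →
    ∃ h : comb ![t, 1 - t] ![(x : S), (y : S)] ∈ convexDomain S,
      j ⟨comb ![t, 1 - t] ![(x : S), (y : S)], h⟩ = t • j x + (1 - t) • j y

end Space

section CondExp

variable {Ω : Type w} (G : MeasurableSpace Ω) {mΩ : MeasurableSpace Ω} (P : Measure Ω)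
  {S : Type u} [MetricSpace S] [MeasurableSpace S] [ConvexCombSpace S]

/-- `X` is an integrable random element of `S`. -/
def IsIntegrable (X : Ω → S) : Prop :=
  Measurable[mΩ] X ∧ ∃ a : S, Integrable (fun ω => dist a (X ω)) P

/-- The conditional expectation `[P(X = x | G), K x]` of a simple random element `X`, where `x`
runs through the finitely many values of `X`. The conditional probabilities are nonnegative and sum
to one outside a null set; the values on that null set are irrelevant. -/
def condExpSimple (X : SimpleFunc Ω S) (ω : Ω) : S :=
  combOn X.range (fun x => (P[(X ⁻¹' {x}).indicator (fun _ => (1 : ℝ)) | G]) ω) convexify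

/-- `Y` is (a version of) the conditional expectation of the random element `X` given `G`: it is
`G`-measurable and almost surely the limit of the conditional expectations of the simple random
elements `ψ n ∘ X`, where `ψ n x` is the point closest to `x` among `e 0, …, e n` (the one
with the smallest index if there are several). -/
def IsCondExp [OpensMeasurableSpace S] (e : ℕ → S) (X Y : Ω → S) : Prop :=
  ∃ hX : Measurable[mΩ] X, Measurable[G] Y ∧
    ∀ᵐ ω ∂P, Tendsto (fun n => condExpSimple G P ((SimpleFunc.nearestPt e n).comp X hX) ω)
      atTop (𝓝 (Y ω))

end CondExp

end

end ConvexCombSpace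

open scoped NNReal

/-! Give each point a positive mass and add two weighted points by adding the masses and combining
the points. The axioms make this a commutative semigroup, and every n-ary combination becomes a sum
in it (`sum_weighted`), so rearranging combinations is ordinary algebra. In this cone `convexify` is
seen to be a 1-Lipschitz affine retraction onto a closed set K(S), on which masses split: a point of
mass `a + b` is the sum of the same point with masses `a` and `b` (`weighted_add_self`).

The crucial fact is that the curvature inequality becomes an equality when the same term is added on
both sides (`mul_dist_eq_of_weighted_add`). Hence mass times distance of barycenters is a
cancellative distance between equal-mass families over K(S). As in Rådström's construction, it
extends to a seminorm on formal linear combinations, and the Hausdorff completion is a Banach space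
that contains K(S) isometrically and affinely.

For simple `X`, any such `j` carries the defining combination to a weighted sum that is the
Banach-valued conditional expectation of `j (K X)`. The general case follows by approximation: `j ∘
K` is 1-Lipschitz, the distances from `ψ n (X)` to `X` decrease to zero, and the image of `j` is
closed. Idempotence of `K` gives the same value for `K X`. -/

namespace ConvexCombSpace

/-! ### The semigroup of weighted points -/

section WeightedPoint

variable {S : Type u}

/-- A point of `S` together with a positive mass. -/
@[ext]
structure WeightedPoint (S : Type u) where
  mass : ℝ
  mass_pos : 0 < mass
  pt : S

namespace WeightedPoint

/-- Multiply the mass by a positive number. -/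
def scale (c : ℝ) (hc : 0 < c) (p : WeightedPoint S) : WeightedPoint S :=
  ⟨c * p.mass, mul_pos hc p.mass_pos, p.pt⟩

variable [MetricSpace S] [ConvexCombSpace S]

noncomputable instance : Add (WeightedPoint S) where
  add p q := ⟨p.mass + q.mass, add_pos p.mass_pos q.mass_pos,
    comb ![p.mass / (p.mass + q.mass), q.mass / (p.mass + q.mass)] ![p.pt, q.pt]⟩

theorem mass_add (p q : WeightedPoint S) : (p + q).mass = p.mass + q.mass := rfl

theorem pt_add (p q : WeightedPoint S) : (p + q).pt =
    comb ![p.mass / (p.mass + q.mass), q.mass / (p.mass + q.mass)] ![p.pt, q.pt] := rfl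

theorem pt_add_eq (p q : WeightedPoint S) {t : ℝ} (h : p.mass = t * (p.mass + q.mass)) :
    (p + q).pt = comb ![t, 1 - t] ![p.pt, q.pt] := by
  have hs : p.mass + q.mass ≠ 0 := (add_pos p.mass_pos q.mass_pos).ne'
  have h1 : p.mass / (p.mass + q.mass) = t := by rw [div_eq_iff hs]; exact h
  have h2 : q.mass / (p.mass + q.mass) = 1 - t := by rw [div_eq_iff hs]; linarith
  rw [pt_add, h1, h2]

protected theorem add_comm (p q : WeightedPoint S) : p + q = q + p := by
  have hs : p.mass + q.mass ≠ 0 := (add_pos p.mass_pos q.mass_pos).ne'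
  ext
  · rw [mass_add, mass_add, _root_.add_comm]
  · rw [pt_add, pt_add, comb_perm _ _ _ _ (Equiv.swap 0 1)]
    · rw [_root_.add_comm q.mass]
      congr 1 <;> · ext i; fin_cases i <;> simp
    · have := p.mass_pos
      have := q.mass_pos
      intro i; fin_cases i <;> simp <;> positivity
    · simp [Fin.sum_univ_two, ← add_div, hs]

theorem pt_add_add (p q r : WeightedPoint S) : (p + (q + r)).pt =
    comb ![p.mass / (p.mass + q.mass + r.mass), q.mass / (p.mass + q.mass + r.mass),
      r.mass / (p.mass + q.mass + r.mass)] ![p.pt, q.pt, r.pt] := by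
  have hp := p.mass_pos
  have hq := q.mass_pos
  have hr := r.mass_pos
  set s := p.mass + q.mass + r.mass with hs
  have hs0 : 0 < s := by positivity
  have h := comb_assoc ![p.mass / s] ![p.pt] (q.mass / s) (r.mass / s) q.pt r.pt
    (by intro i; fin_cases i; simpa using div_pos hp hs0) (by positivity) (by positivity)
    (by simp [← add_div, ← hs, hs0.ne'])
  have e1 : (Fin.snoc (Fin.snoc ![p.mass / s] (q.mass / s) : Fin 2 → ℝ) (r.mass / s) : Fin 3 → ℝ)
      = ![p.mass / s, q.mass / s, r.mass / s] := by
    ext i; fin_cases i <;> rfl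
  have e2 : (Fin.snoc (Fin.snoc ![p.pt] q.pt : Fin 2 → S) r.pt : Fin 3 → S)
      = ![p.pt, q.pt, r.pt] := by
    ext i; fin_cases i <;> rfl
  have e3 : ∀ a b : ℝ, (Fin.snoc ![a] b : Fin 2 → ℝ) = ![a, b] := by
    intro a b; ext i; fin_cases i <;> rfl
  have e4 : ∀ a b : S, (Fin.snoc ![a] b : Fin 2 → S) = ![a, b] := by
    intro a b; ext i; fin_cases i <;> rfl
  have e5 : ∀ a : ℝ, a / s / (q.mass / s + r.mass / s) = a / (q.mass + r.mass) := by
    intro a; rw [← add_div, div_div_div_cancel_right₀ hs0.ne']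
  rw [e1, e2, e3, e4, e5, e5, ← add_div] at h
  rw [h, pt_add, pt_add, mass_add, ← _root_.add_assoc]

/-- The symmetric three-term form of `pt_add_add` lets `comb_perm` act by a cyclic shift. Together
with commutativity of `+`, this rotation yields associativity. -/
theorem pt_rotate (p q r : WeightedPoint S) : (p + (q + r)).pt = (r + (p + q)).pt := by
  have hp := p.mass_pos
  have hq := q.mass_pos
  have hr := r.mass_pos
  rw [pt_add_add, pt_add_add, comb_perm _ _ _ _ (finRotate 3).symm]
  · have : p.mass + q.mass + r.mass = r.mass + p.mass + q.mass := by ring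
    rw [this]
    congr 1 <;> · ext i; fin_cases i <;> rfl
  · intro i; fin_cases i <;> simp <;> positivity
  · simp only [Fin.sum_univ_three, Matrix.cons_val_zero, Matrix.cons_val_one, Matrix.cons_val]
    field_simp

noncomputable instance : AddCommSemigroup (WeightedPoint S) where
  add_comm := WeightedPoint.add_comm
  add_assoc p q r := by
    rw [WeightedPoint.add_comm (p + q)]
    ext
    · simp only [mass_add]; ring
    · exact (pt_rotate p q r).symm

theorem scale_add (c : ℝ) (hc : 0 < c) (p q : WeightedPoint S) :
    scale c hc (p + q) = scale c hc p + scale c hc q := by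
  ext
  · simp [scale, mass_add, mul_add]
  · have e : ∀ a : ℝ, c * a / (c * p.mass + c * q.mass) = a / (p.mass + q.mass) := fun a => by
      rw [← mul_add, mul_div_mul_left _ _ hc.ne']
    simp only [scale, pt_add, e]

end WeightedPoint

end WeightedPoint

/-! ### The cone over the space, with the zero mass adjoined -/

section Cone

variable {S : Type u}

/-- The point `x` with mass `a`, as an element of the cone over `S`. It is `0` if `a ≤ 0`. -/
noncomputable def weighted (a : ℝ) (x : S) : WithZero (WeightedPoint S) :=
  if h : 0 < a then ((⟨a, h, x⟩ : WeightedPoint S) : WithZero (WeightedPoint S)) else 0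

theorem weighted_of_pos {a : ℝ} (h : 0 < a) (x : S) :
    weighted a x = ((⟨a, h, x⟩ : WeightedPoint S) : WithZero (WeightedPoint S)) := dif_pos h

@[simp]
theorem weighted_zero (x : S) : weighted 0 x = 0 := dif_neg (lt_irrefl _)

theorem weighted_injective {a : ℝ} (h : 0 < a) : Function.Injective (weighted (S := S) a) := by
  intro x y hxy
  rw [weighted_of_pos h, weighted_of_pos h, WithZero.coe_inj] at hxy
  exact congrArg WeightedPoint.pt hxy

variable [MetricSpace S] [ConvexCombSpace S]

/-- Binary convex combinations. -/
noncomputable def mix (t : ℝ) (x y : S) : S := comb ![t, 1 - t] ![x, y]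

theorem weighted_add {a b : ℝ} (ha : 0 < a) (hb : 0 < b) (x y : S) :
    weighted a x + weighted b y = weighted (a + b) (mix (a / (a + b)) x y) := by
  rw [weighted_of_pos ha, weighted_of_pos hb, weighted_of_pos (add_pos ha hb), ← WithZero.coe_add,
    WithZero.coe_inj]
  ext
  · rfl
  · refine WeightedPoint.pt_add_eq _ _ ?_
    exact (div_mul_cancel₀ a (add_pos ha hb).ne').symm

theorem weighted_mix {t : ℝ} (h₀ : 0 < t) (h₁ : t < 1) {c : ℝ} (hc : 0 < c) (x y : S) :
    weighted c (mix t x y) = weighted (t * c) x + weighted ((1 - t) * c) y := by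
  have e : t * c + (1 - t) * c = c := by ring
  rw [weighted_add (mul_pos h₀ hc) (mul_pos (sub_pos.2 h₁) hc), e, mul_div_cancel_right₀ _ hc.ne']

/-- Induction on the number of terms: `comb_assoc` merges the last two, which is addition in the
cone. From here on n-ary combinations are handled as sums. -/
theorem sum_weighted {n : ℕ} (lam : Fin n → ℝ) (x : Fin n → S) :
    (∀ i, 0 < lam i) → ∑ i, lam i = 1 →
      ∑ i, weighted (lam i) (x i) = weighted 1 (comb lam x) := by
  induction n with
  | zero => intro _ h; simp at h
  | succ n ih =>
    cases n with
    | zero =>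
      intro _ h
      have h0 : lam 0 = 1 := by simpa using h
      have e1 : lam = fun _ => 1 := by ext i; rw [Fin.fin_one_eq_zero i, h0]
      have e2 : x = fun _ => x 0 := by ext i; rw [Fin.fin_one_eq_zero i]
      rw [e1, e2, comb_one]
      simp
    | succ n =>
      intro hpos hsum
      set l' : Fin n → ℝ := Fin.init (Fin.init lam) with hl
      set x' : Fin n → S := Fin.init (Fin.init x) with hx
      set a := lam (Fin.last n).castSucc with ha'
      set b := lam (Fin.last (n + 1)) with hb'
      set y := x (Fin.last n).castSucc
      set z := x (Fin.last (n + 1))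
      have el : lam = (Fin.snoc (Fin.snoc l' a : Fin (n + 1) → ℝ) b : Fin (n + 2) → ℝ) := by
        rw [hl, ha', hb']
        have := Fin.snoc_init_self (Fin.init lam)
        exact ((congrArg (fun f => (Fin.snoc f b : Fin (n + 2) → ℝ)) this).trans
          (Fin.snoc_init_self lam)).symm
      have ex : x = (Fin.snoc (Fin.snoc x' y : Fin (n + 1) → S) z : Fin (n + 2) → S) := by
        have := Fin.snoc_init_self (Fin.init x)
        exact ((congrArg (fun f => (Fin.snoc f z : Fin (n + 2) → S)) this).trans
          (Fin.snoc_init_self x)).symm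
      have ha : 0 < a := hpos _
      have hb : 0 < b := hpos _
      have hl0 : ∀ i, 0 < l' i := fun i => hpos _
      have hs : ∑ i, l' i + a + b = 1 := by
        rw [Fin.sum_univ_castSucc, Fin.sum_univ_castSucc] at hsum
        exact hsum
      have hba : b / (a + b) = 1 - a / (a + b) := by
        have := (add_pos ha hb).ne'
        field_simp
        ring
      rw [el, ex, comb_assoc l' x' a b y z hl0 ha hb hs, ← ih]
      · simp only [Fin.sum_univ_castSucc, Fin.snoc_castSucc, Fin.snoc_last]
        rw [add_assoc, weighted_add ha hb, hba]
        rfl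
      · intro i
        refine Fin.lastCases ?_ (fun i => ?_) i
        · simpa using add_pos ha hb
        · simpa using hl0 i
      · simpa [Fin.sum_univ_castSucc, add_assoc] using hs

/-- Multiplication of all masses by a positive number. -/
noncomputable def scaleHom (c : ℝ) (hc : 0 < c) :
    WithZero (WeightedPoint S) →+ WithZero (WeightedPoint S) where
  toFun := WithZero.recZeroCoe 0 fun p => (WeightedPoint.scale c hc p : WithZero (WeightedPoint S))
  map_zero' := rfl
  map_add' p q := by
    induction p with
    | zero => rw [zero_add]; exact (zero_add _).symm
    | coe p =>
      induction q with
      | zero => rw [add_zero]; exact (add_zero _).symm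
      | coe q => exact congrArg WithZero.coe (WeightedPoint.scale_add c hc p q)

theorem scaleHom_weighted {c : ℝ} (hc : 0 < c) (a : ℝ) (x : S) :
    scaleHom c hc (weighted a x) = weighted (c * a) x := by
  by_cases ha : 0 < a
  · rw [weighted_of_pos ha, weighted_of_pos (mul_pos hc ha)]; rfl
  · rw [weighted, dif_neg ha, weighted, dif_neg (by simpa [mul_pos_iff_of_pos_left hc] using ha),
      map_zero]

theorem dist_mix_le {t : ℝ} (h₀ : 0 < t) (h₁ : t < 1) (x₁ x₂ y₁ y₂ : S) :
    dist (mix t x₁ x₂) (mix t y₁ y₂) ≤ t * dist x₁ y₁ + (1 - t) * dist x₂ y₂ :=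
  dist_comb_le t x₁ x₂ y₁ y₂ h₀ h₁

/-- Negative curvature in homogeneous form. Multiplying by the total mass removes the normalisation
and lets zero masses be included. -/
theorem mul_dist_le_of_weighted_add {a b : ℝ} (ha : 0 ≤ a) (hb : 0 ≤ b) {x y z w p q : S}
    (hp : weighted a x + weighted b z = weighted (a + b) p)
    (hq : weighted a y + weighted b w = weighted (a + b) q) :
    (a + b) * dist p q ≤ a * dist x y + b * dist z w := by
  rcases ha.eq_or_lt with rfl | ha
  · rcases hb.eq_or_lt with rfl | hb
    · simp
    · simp only [weighted_zero, zero_add] at hp hq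
      rw [weighted_injective hb hp, weighted_injective hb hq]
      simp
  · rcases hb.eq_or_lt with rfl | hb
    · simp only [weighted_zero, add_zero] at hp hq
      rw [weighted_injective ha hp, weighted_injective ha hq]
      simp
    · have hs := add_pos ha hb
      rw [weighted_add ha hb] at hp hq
      rw [← weighted_injective hs hp, ← weighted_injective hs hq]
      have h := dist_mix_le (div_pos ha hs) ((div_lt_one hs).2 (by linarith)) x z y w
      calc (a + b) * _ ≤ (a + b) * _ := mul_le_mul_of_nonneg_left h hs.le
        _ = _ := by field_simp; ring

/-! ### The convexification operator and its range -/

/-- The average of `n` copies of `x`. -/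
noncomputable def selfAverage (n : ℕ) (x : S) : S := comb (fun _ : Fin n => (n : ℝ)⁻¹) (fun _ => x)

theorem weighted_selfAverage {n : ℕ} (hn : 0 < n) {a : ℝ} (ha : 0 < a) (x : S) :
    weighted a (selfAverage n x) = n • weighted (a / n) x := by
  have hn' : (0 : ℝ) < n := Nat.cast_pos.2 hn
  have h := sum_weighted (fun _ : Fin n => (n : ℝ)⁻¹) (fun _ => x)
    (fun _ => inv_pos.2 hn') (by simp [hn'.ne'])
  have h2 := congrArg (scaleHom a ha) h
  simp only [Finset.sum_const, Finset.card_univ, Fintype.card_fin, map_nsmul, scaleHom_weighted,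
    mul_one] at h2
  rw [div_eq_mul_inv, h2]
  rfl

theorem dist_selfAverage_le {n : ℕ} (hn : 0 < n) (x y : S) :
    dist (selfAverage n x) (selfAverage n y) ≤ dist x y := by
  -- Unnormalised sums of `n + 1` copies: the induction step then adds one unit mass, at a cost of
  -- at most `dist x y`.
  suffices H : ∀ n : ℕ, ∃ p q : S, (n + 1) • weighted 1 x = weighted ((n : ℝ) + 1) p ∧
      (n + 1) • weighted 1 y = weighted ((n : ℝ) + 1) q ∧ dist p q ≤ dist x y by
    obtain ⟨k, rfl⟩ := Nat.exists_eq_succ_of_ne_zero hn.ne'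
    obtain ⟨p, q, hp, hq, h⟩ := H k
    have hk : (0 : ℝ) < (k : ℝ) + 1 := by positivity
    have hx := weighted_selfAverage hn hk x
    have hy := weighted_selfAverage hn hk y
    simp only [Nat.succ_eq_add_one, Nat.cast_add, Nat.cast_one, div_self hk.ne'] at hx hy
    rw [weighted_injective hk (hx.trans hp), weighted_injective hk (hy.trans hq)]
    exact h
  intro n
  induction n with
  | zero => exact ⟨x, y, by simp, by simp, le_rfl⟩
  | succ n ih =>
    obtain ⟨p, q, hp, hq, h⟩ := ih
    have hk : (0 : ℝ) < (n : ℝ) + 1 := by positivity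
    have hk' : (((n + 1 : ℕ) : ℝ) + 1) = (n + 1) + 1 := by push_cast; rfl
    refine ⟨mix ((n + 1 : ℝ) / ((n + 1) + 1)) p x, mix ((n + 1 : ℝ) / ((n + 1) + 1)) q y, ?_, ?_, ?_⟩
    · rw [succ_nsmul, hp, weighted_add hk one_pos, hk']
    · rw [succ_nsmul, hq, weighted_add hk one_pos, hk']
    · have h2 := mul_dist_le_of_weighted_add hk.le zero_le_one (weighted_add hk one_pos p x)
        (weighted_add hk one_pos q y)
      refine le_of_mul_le_mul_left (h2.trans ?_) (add_pos hk one_pos)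
      nlinarith

theorem tendsto_selfAverage (x : S) :
    Tendsto (fun n => selfAverage n x) atTop (𝓝 (convexify x)) := tendsto_convexify x

theorem dist_convexify_le (x y : S) : dist (convexify x) (convexify y) ≤ dist x y :=
  le_of_tendsto ((tendsto_selfAverage x).dist (tendsto_selfAverage y))
    ((eventually_gt_atTop 0).mono fun _ hn => dist_selfAverage_le hn x y)

theorem lipschitzWith_convexify : LipschitzWith 1 (convexify : S → S) :=
  LipschitzWith.of_dist_le_mul fun x y => by simpa using dist_convexify_le x y

theorem tendsto_mix {t : ℝ} (h₀ : 0 < t) (h₁ : t < 1) {ι : Type*} {l : Filter ι} {f g : ι → S}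
    {x y : S} (hf : Tendsto f l (𝓝 x)) (hg : Tendsto g l (𝓝 y)) :
    Tendsto (fun i => mix t (f i) (g i)) l (𝓝 (mix t x y)) := by
  rw [tendsto_iff_dist_tendsto_zero] at hf hg ⊢
  refine squeeze_zero (fun _ => dist_nonneg) (fun i => dist_mix_le h₀ h₁ _ _ _ _) ?_
  simpa using (hf.const_mul t).add (hg.const_mul (1 - t))

theorem selfAverage_mix {n : ℕ} (hn : 0 < n) {t : ℝ} (h₀ : 0 < t) (h₁ : t < 1) (x y : S) :
    selfAverage n (mix t x y) = mix t (selfAverage n x) (selfAverage n y) := by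
  have hn' : (0 : ℝ) < n := Nat.cast_pos.2 hn
  apply weighted_injective one_pos
  rw [weighted_selfAverage hn one_pos, weighted_mix h₀ h₁ one_pos, weighted_mix h₀ h₁ (by positivity),
    mul_one, mul_one, weighted_selfAverage hn h₀, weighted_selfAverage hn (sub_pos.2 h₁), nsmul_add,
    mul_one_div, mul_one_div]

theorem convexify_mix {t : ℝ} (h₀ : 0 < t) (h₁ : t < 1) (x y : S) :
    convexify (mix t x y) = mix t (convexify x) (convexify y) :=
  tendsto_nhds_unique (tendsto_selfAverage _) <|
    (tendsto_mix h₀ h₁ (tendsto_selfAverage x) (tendsto_selfAverage y)).congr' <|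
      (eventually_gt_atTop 0).mono fun _ hn => (selfAverage_mix hn h₀ h₁ x y).symm

theorem selfAverage_add_mul {k l n : ℕ} (hk : 0 < k) (hl : 0 < l) (hn : 0 < n) (x : S) :
    selfAverage ((k + l) * n) x =
      mix ((k : ℝ) / (k + l)) (selfAverage (k * n) x) (selfAverage (l * n) x) := by
  have hn' : (0 : ℝ) < n := Nat.cast_pos.2 hn
  have hk' : (0 : ℝ) < k := Nat.cast_pos.2 hk
  have hl' : (0 : ℝ) < l := Nat.cast_pos.2 hl
  have hs : (0 : ℝ) < k + l := by positivity
  apply weighted_injective hs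
  rw [← weighted_add hk' hl', weighted_selfAverage (by positivity) hs,
    weighted_selfAverage (by positivity) hk', weighted_selfAverage (by positivity) hl']
  have e : ∀ a : ℝ, 0 < a → a / (a * n) = 1 / n := fun a ha => by field_simp
  push_cast
  rw [e _ hs, e _ hk', e _ hl', add_mul, add_nsmul]

/-- The averages of `k * n`, `l * n` and `(k + l) * n` copies of `x` all tend to `convexify x` as
`n` grows, so `selfAverage_add_mul` passes to the limit. -/
theorem mix_div_convexify {k l : ℕ} (hk : 0 < k) (hl : 0 < l) (x : S) :
    mix ((k : ℝ) / (k + l)) (convexify x) (convexify x) = convexify x := by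
  have hk' : (0 : ℝ) < k := Nat.cast_pos.2 hk
  have hl' : (0 : ℝ) < l := Nat.cast_pos.2 hl
  have ht : ∀ m : ℕ, 0 < m → Tendsto (fun n => selfAverage (m * n) x) atTop (𝓝 (convexify x)) :=
    fun m hm => (tendsto_selfAverage x).comp (tendsto_id.const_mul_atTop' hm)
  refine tendsto_nhds_unique (tendsto_mix (by positivity)
    ((div_lt_one (by positivity)).2 (by linarith)) (ht k hk) (ht l hl)) ?_
  exact (ht (k + l) (by positivity)).congr' <|
    (eventually_gt_atTop 0).mono fun _ hn => selfAverage_add_mul hk hl hn x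

/-- Rational weights are covered by `mix_div_convexify`; continuity in the weight and density of the
rationals give the rest. -/
theorem mix_convexify_self {t : ℝ} (h₀ : 0 < t) (h₁ : t < 1) (x : S) :
    mix t (convexify x) (convexify x) = convexify x := by
  have hc := (comb_continuous (convexify x) (convexify x)) t ⟨h₀, h₁⟩
  have hd : t ∈ closure (Set.Ioo 0 1 ∩ Set.range ((↑) : ℚ → ℝ)) :=
    Rat.isDenseEmbedding_coe_real.dense.open_subset_closure_inter isOpen_Ioo ⟨h₀, h₁⟩
  have : (𝓝[Set.Ioo 0 1 ∩ Set.range ((↑) : ℚ → ℝ)] t).NeBot := mem_closure_iff_nhdsWithin_neBot.1 hd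
  refine tendsto_nhds_unique (f := fun s => mix s (convexify x) (convexify x))
    (l := 𝓝[Set.Ioo 0 1 ∩ Set.range ((↑) : ℚ → ℝ)] t)
    (hc.mono_left (nhdsWithin_mono _ Set.inter_subset_left)) ?_
  refine tendsto_const_nhds.congr' ?_
  filter_upwards [self_mem_nhdsWithin] with s hs
  obtain ⟨⟨h0, h1⟩, r, rfl⟩ := hs
  have h0' : (0 : ℚ) < r := by exact_mod_cast h0
  have h1' : r < 1 := by exact_mod_cast h1
  have hnum : 0 < r.num := Rat.num_pos.2 h0'
  have hlt : r.num < r.den := Rat.num_lt_denom_iff.2 h1'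
  obtain ⟨k, hk⟩ := Int.eq_ofNat_of_zero_le hnum.le
  obtain ⟨l, hl⟩ := Int.eq_ofNat_of_zero_le (sub_nonneg.2 hlt.le)
  -- Here `k` is the numerator of `r` and `l` its denominator minus its numerator.
  have hr : (r : ℝ) = (k : ℝ) / (k + l) := by
    have e : ((k : ℝ) + l) = r.den := by
      have : (k : ℤ) + l = r.den := by omega
      exact_mod_cast this
    rw [e, Rat.cast_def, hk]; rfl
  rw [hr]
  exact (mix_div_convexify (by omega) (by omega) x).symm

/-- The defining advantage of K(S): for fixed `x` there, `weighted · x` is additive on nonnegative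
masses. -/
theorem weighted_add_self {x : S} (hx : x ∈ convexDomain S) {a b : ℝ} (ha : 0 ≤ a) (hb : 0 ≤ b) :
    weighted (a + b) x = weighted a x + weighted b x := by
  obtain ⟨y, rfl⟩ := hx
  rcases ha.eq_or_lt with rfl | ha
  · simp
  rcases hb.eq_or_lt with rfl | hb
  · simp
  have hs := add_pos ha hb
  rw [weighted_add ha hb, mix_convexify_self (div_pos ha hs) ((div_lt_one hs).2 (by linarith))]

theorem nsmul_weighted {x : S} (hx : x ∈ convexDomain S) {a : ℝ} (ha : 0 ≤ a) (n : ℕ) :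
    n • weighted a x = weighted (n * a) x := by
  induction n with
  | zero => simp
  | succ n ih =>
    rw [succ_nsmul, ih, ← weighted_add_self hx (by positivity) ha]
    push_cast
    congr 1
    ring

theorem convexify_of_mem {x : S} (hx : x ∈ convexDomain S) : convexify x = x := by
  refine tendsto_nhds_unique (tendsto_selfAverage x) (tendsto_const_nhds.congr' ?_)
  filter_upwards [eventually_gt_atTop 0] with n hn
  have hn' : (0 : ℝ) < n := Nat.cast_pos.2 hn
  apply weighted_injective one_pos
  rw [weighted_selfAverage hn one_pos, nsmul_weighted hx (by positivity), mul_one_div,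
    div_self hn'.ne']

theorem mix_mem {x y : S} (hx : x ∈ convexDomain S) (hy : y ∈ convexDomain S) {t : ℝ}
    (h₀ : 0 < t) (h₁ : t < 1) : mix t x y ∈ convexDomain S :=
  ⟨mix t x y, by rw [convexify_mix h₀ h₁, convexify_of_mem hx, convexify_of_mem hy]⟩

theorem isClosed_convexDomain : IsClosed (convexDomain S) := by
  have : convexDomain S = {x | convexify x = x} :=
    Set.ext fun x => ⟨convexify_of_mem, fun h => ⟨x, h⟩⟩
  rw [this]
  exact isClosed_eq lipschitzWith_convexify.continuous continuous_id

end Cone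

/-! ### Cancellation of a common term -/

section Homogeneity

variable {S : Type u} [MetricSpace S] [ConvexCombSpace S]

/-- The barycenter `m` of `x + y + r z` lies between `p'` and `q'`: replacing `p` by `q` in `x + (1
+ r) p` leads from `p'` to `m`, and the same replacement in `y + (1 + r) p` leads from `m` to `q'`.
Each costs at most `(1 + r) * dist p q`. -/
theorem one_add_half_mul_dist_le {x y z : S} (hx : x ∈ convexDomain S) (hy : y ∈ convexDomain S)
    {r : ℝ} (hr : 0 < r) {p q p' q' : S}
    (hp : weighted 1 x + weighted r z = weighted (1 + r) p)
    (hq : weighted 1 y + weighted r z = weighted (1 + r) q)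
    (hp' : weighted 2 x + weighted r z = weighted (2 + r) p')
    (hq' : weighted 2 y + weighted r z = weighted (2 + r) q') :
    (2 + r) * dist p' q' ≤ 2 * ((1 + r) * dist p q) := by
  have hr1 : 0 < 1 + r := by linarith
  have h2 : (2 : ℝ) = 1 + 1 := by norm_num
  have h2r : 1 + (1 + r) = 2 + r := by ring
  obtain ⟨m, hm⟩ : ∃ m, weighted 1 x + weighted (1 + r) q = weighted (1 + (1 + r)) m :=
    ⟨_, weighted_add one_pos hr1 x q⟩
  have hm' : weighted 1 y + weighted (1 + r) p = weighted (1 + (1 + r)) m := by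
    rw [← hm, ← hp, ← hq, add_left_comm]
  have e1 : weighted 1 x + weighted (1 + r) p = weighted (1 + (1 + r)) p' := by
    rw [h2r, ← hp', ← hp, ← add_assoc, ← weighted_add_self hx zero_le_one zero_le_one, ← h2]
  have e2 : weighted 1 y + weighted (1 + r) q = weighted (1 + (1 + r)) q' := by
    rw [h2r, ← hq', ← hq, ← add_assoc, ← weighted_add_self hy zero_le_one zero_le_one, ← h2]
  have d1 := mul_dist_le_of_weighted_add zero_le_one hr1.le e1 hm
  have d2 := mul_dist_le_of_weighted_add zero_le_one hr1.le hm' e2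
  rw [dist_self, h2r] at d1 d2
  nlinarith [dist_triangle p' m q']

/-- By `one_add_half_mul_dist_le`, halving the mass of `z` does not increase total mass times
distance. Iterating, the mass of `z` tends to zero and the barycenters tend to `x` and `y`. -/
theorem le_mul_dist_of_weighted_add {x y z : S} (hx : x ∈ convexDomain S)
    (hy : y ∈ convexDomain S) {r : ℝ} (hr : 0 < r) {p q : S}
    (hp : weighted 1 x + weighted r z = weighted (1 + r) p)
    (hq : weighted 1 y + weighted r z = weighted (1 + r) q) :
    dist x y ≤ (1 + r) * dist p q := by
  have H : ∀ n : ℕ, ∃ p' q' : S, weighted 1 x + weighted (r / 2 ^ n) z =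
      weighted (1 + r / 2 ^ n) p' ∧
      weighted 1 y + weighted (r / 2 ^ n) z = weighted (1 + r / 2 ^ n) q' ∧
      (1 + r / 2 ^ n) * dist p' q' ≤ (1 + r) * dist p q := by
    intro n
    induction n with
    | zero => exact ⟨p, q, by simpa using hp, by simpa using hq, by simp⟩
    | succ n ih =>
      obtain ⟨p₁, q₁, hp₁, hq₁, h⟩ := ih
      set s := r / 2 ^ n with hs
      have hs0 : 0 < s := by positivity
      have e : r / 2 ^ (n + 1) = s / 2 := by rw [hs, pow_succ, div_div]
      have hs2 : 0 < s / 2 := by positivity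
      have key : ∀ w : S, weighted 1 w + weighted (s / 2) z =
            weighted (1 + s / 2) (mix (1 / (1 + s / 2)) w z) ∧
          weighted 2 w + weighted s z = weighted (2 + s) (mix (1 / (1 + s / 2)) w z) := by
        intro w
        have h1 := weighted_add one_pos hs2 w z
        have h2 := congrArg (scaleHom 2 two_pos) h1
        rw [map_add, scaleHom_weighted, scaleHom_weighted, scaleHom_weighted] at h2
        refine ⟨h1, ?_⟩
        convert h2 using 3 <;> ring
      rw [e]
      refine ⟨_, _, (key x).1, (key y).1, ?_⟩
      have := one_add_half_mul_dist_le hx hy hs0 hp₁ hq₁ (key x).2 (key y).2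
      linarith
  -- The error term bounds `dist x p' + dist q' y`, up to the factor `1 + r / 2 ^ n`.
  have hlim : Tendsto (fun n : ℕ => (1 + r) * dist p q + r / 2 ^ n * (dist x z + dist y z)) atTop
      (𝓝 ((1 + r) * dist p q + 0 * (dist x z + dist y z))) := by
    refine tendsto_const_nhds.add (Tendsto.mul_const _ ?_)
    have := (tendsto_pow_atTop_nhds_zero_of_lt_one (r := (1 / 2 : ℝ)) (by norm_num)
      (by norm_num)).const_mul r
    simpa [div_eq_mul_inv] using this
  rw [zero_mul, add_zero] at hlim
  refine ge_of_tendsto' hlim fun n => ?_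
  obtain ⟨p', q', hp', hq', h⟩ := H n
  set s := r / 2 ^ n
  have hs0 : 0 < s := by positivity
  have dx := mul_dist_le_of_weighted_add zero_le_one hs0.le
    (weighted_add_self hx zero_le_one hs0.le).symm hp'
  have dy := mul_dist_le_of_weighted_add zero_le_one hs0.le hq'
    (weighted_add_self hy zero_le_one hs0.le).symm
  rw [dist_self, dist_comm z y] at *
  have t1 := dist_triangle x p' y
  have t2 := dist_triangle p' q' y
  nlinarith [dist_nonneg (x := x) (y := y)]

/-- Adding a common term does not change distances, up to the change in the weights. -/
theorem mul_dist_eq_of_weighted_add {x y z : S} (hx : x ∈ convexDomain S)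
    (hy : y ∈ convexDomain S) {a b : ℝ} (ha : 0 < a) (hb : 0 ≤ b) {p q : S}
    (hp : weighted a x + weighted b z = weighted (a + b) p)
    (hq : weighted a y + weighted b z = weighted (a + b) q) :
    (a + b) * dist p q = a * dist x y := by
  apply le_antisymm
  · simpa using mul_dist_le_of_weighted_add ha.le hb hp hq
  rcases hb.eq_or_lt with rfl | hb
  · simp only [weighted_zero, add_zero] at hp hq ⊢
    rw [weighted_injective ha hp, weighted_injective ha hq]
  have hp' := congrArg (scaleHom a⁻¹ (inv_pos.2 ha)) hp
  have hq' := congrArg (scaleHom a⁻¹ (inv_pos.2 ha)) hq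
  simp only [map_add, scaleHom_weighted, mul_add, inv_mul_cancel₀ ha.ne'] at hp' hq'
  have h := le_mul_dist_of_weighted_add hx hy (by positivity) hp' hq'
  calc a * dist x y ≤ a * ((1 + a⁻¹ * b) * dist p q) := mul_le_mul_of_nonneg_left h ha.le
    _ = (a + b) * dist p q := by field_simp

end Homogeneity

/-! ### A seminorm on formal combinations of points of K(S) -/

section Embedding

theorem degree_smul {C : Type u} {R : Type*} [Semiring R] (c : R) (f : C →₀ R) :
    (c • f).degree = c * f.degree := by
  induction f using Finsupp.induction_linear with
  | zero => simp
  | add f g hf hg => rw [smul_add, map_add, map_add, hf, hg, mul_add]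
  | single x a =>
    rw [Finsupp.smul_single, Finsupp.degree_single, Finsupp.degree_single, smul_eq_mul]

variable {S : Type u} [MetricSpace S] [ConvexCombSpace S]

/-- The formal barycenter of finitely many points of the convexifiable domain with masses. -/
noncomputable def barycenterHom : (convexDomain S →₀ ℝ≥0) →+ WithZero (WeightedPoint S) :=
  Finsupp.liftAddHom fun x =>
    { toFun := fun a => weighted (a : ℝ) (x : S)
      map_zero' := by simp
      map_add' := fun a b => by
        exact weighted_add_self x.2 (NNReal.coe_nonneg a) (NNReal.coe_nonneg b) }

theorem barycenterHom_single (x : convexDomain S) (a : ℝ≥0) :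
    barycenterHom (Finsupp.single x a) = weighted (a : ℝ) (x : S) := by
  simp only [barycenterHom, Finsupp.liftAddHom_apply_single]
  rfl

theorem barycenterHom_smul {c : ℝ≥0} (hc : 0 < c) (p : convexDomain S →₀ ℝ≥0) :
    barycenterHom (c • p) = scaleHom (c : ℝ) (NNReal.coe_pos.2 hc) (barycenterHom p) := by
  induction p using Finsupp.induction_linear with
  | zero => simp
  | add p q hp hq => rw [smul_add, map_add, map_add, map_add, hp, hq]
  | single x a =>
    rw [Finsupp.smul_single, barycenterHom_single, barycenterHom_single, scaleHom_weighted,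
      smul_eq_mul, NNReal.coe_mul]

theorem exists_barycenter [Nonempty (convexDomain S)] (p : convexDomain S →₀ ℝ≥0) :
    ∃ x : convexDomain S, barycenterHom p = weighted (p.degree : ℝ) (x : S) := by
  induction p using Finsupp.induction_linear with
  | zero => exact ⟨Classical.arbitrary _, by simp⟩
  | add p q hp hq =>
    obtain ⟨x, hx⟩ := hp
    obtain ⟨y, hy⟩ := hq
    rw [map_add, map_add, hx, hy, NNReal.coe_add]
    rcases (NNReal.coe_nonneg p.degree).eq_or_lt with h | h
    · exact ⟨y, by rw [← h]; simp⟩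
    rcases (NNReal.coe_nonneg q.degree).eq_or_lt with h' | h'
    · exact ⟨x, by rw [← h']; simp⟩
    have hs := add_pos h h'
    exact ⟨⟨_, mix_mem x.2 y.2 (div_pos h hs) ((div_lt_one hs).2 (by linarith))⟩,
      weighted_add h h' _ _⟩
  | single x a => exact ⟨x, by rw [barycenterHom_single, Finsupp.degree_single]⟩

variable [Nonempty (convexDomain S)]

/-- A point that, with the total mass of `p`, represents `p`. -/
noncomputable def barycenter (p : convexDomain S →₀ ℝ≥0) : convexDomain S :=
  (exists_barycenter p).choose

theorem barycenterHom_eq (p : convexDomain S →₀ ℝ≥0) :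
    barycenterHom p = weighted (p.degree : ℝ) (barycenter p : S) :=
  (exists_barycenter p).choose_spec

theorem barycenter_eq {p : convexDomain S →₀ ℝ≥0} {a : ℝ} (ha : 0 < a) (hp : p.degree = a)
    {x : convexDomain S} (h : barycenterHom p = weighted a (x : S)) : barycenter p = x := by
  rw [barycenterHom_eq, hp] at h
  exact Subtype.ext (weighted_injective ha h)

/-- The distance of two weighted families of the same total mass. -/
noncomputable def massDist (p q : convexDomain S →₀ ℝ≥0) : ℝ :=
  p.degree * dist (barycenter p) (barycenter q)

theorem massDist_self (p : convexDomain S →₀ ℝ≥0) : massDist p p = 0 := by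
  simp [massDist]

theorem massDist_comm {p q : convexDomain S →₀ ℝ≥0} (h : p.degree = q.degree) :
    massDist p q = massDist q p := by
  rw [massDist, massDist, h, dist_comm]

theorem massDist_add_right {p q : convexDomain S →₀ ℝ≥0} (h : p.degree = q.degree)
    (r : convexDomain S →₀ ℝ≥0) : massDist (p + r) (q + r) = massDist p q := by
  have hp := (map_add barycenterHom p r).symm
  have hq := (map_add barycenterHom q r).symm
  rw [barycenterHom_eq p, barycenterHom_eq r, barycenterHom_eq (p + r), map_add,
    NNReal.coe_add] at hp
  rw [barycenterHom_eq q, barycenterHom_eq r, barycenterHom_eq (q + r), map_add,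
    NNReal.coe_add, ← h] at hq
  rw [massDist, massDist, map_add, NNReal.coe_add]
  rcases (NNReal.coe_nonneg p.degree).eq_or_lt with h0 | h0
  -- The barycenters of massless families are arbitrary, so this case is separate: both sums then
  -- have the barycenter of `r`.
  · rcases (NNReal.coe_nonneg r.degree).eq_or_lt with h1 | h1
    · rw [← h0, ← h1]; simp
    · rw [← h0] at hp hq ⊢
      simp only [weighted_zero, zero_add] at hp hq
      rw [← Subtype.ext (weighted_injective h1 hp), ← Subtype.ext (weighted_injective h1 hq)]
      simp
  · exact mul_dist_eq_of_weighted_add (barycenter p).2 (barycenter q).2 h0 (NNReal.coe_nonneg _)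
      hp hq

theorem massDist_add_le {p q p' q' : convexDomain S →₀ ℝ≥0} (h : p.degree = q.degree)
    (h' : p'.degree = q'.degree) :
    massDist (p + p') (q + q') ≤ massDist p q + massDist p' q' := by
  have hp := (map_add barycenterHom p p').symm
  have hq := (map_add barycenterHom q q').symm
  rw [barycenterHom_eq p, barycenterHom_eq p', barycenterHom_eq (p + p'), map_add,
    NNReal.coe_add] at hp
  rw [barycenterHom_eq q, barycenterHom_eq q', barycenterHom_eq (q + q'), map_add,
    NNReal.coe_add, ← h, ← h'] at hq
  rw [massDist, massDist, massDist, map_add, NNReal.coe_add, Subtype.dist_eq, Subtype.dist_eq,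
    Subtype.dist_eq]
  exact mul_dist_le_of_weighted_add (NNReal.coe_nonneg _) (NNReal.coe_nonneg _) hp hq

/-- `massDist` depends only on the formal difference of its arguments: add `q'` on both sides,
rewrite, and cancel `q`. -/
theorem massDist_congr {p q p' q' : convexDomain S →₀ ℝ≥0} (h : p.degree = q.degree)
    (h' : p'.degree = q'.degree) (e : p + q' = p' + q) : massDist p q = massDist p' q' := by
  rw [← massDist_add_right h q', e, add_comm q q', massDist_add_right h' q]

theorem massDist_smul (c : ℝ≥0) (p q : convexDomain S →₀ ℝ≥0) (h : p.degree = q.degree) :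
    massDist (c • p) (c • q) = c * massDist p q := by
  rcases eq_zero_or_pos c with rfl | hc
  · simp [massDist]
  have hd := degree_smul (C := convexDomain S) c
  rcases (NNReal.coe_nonneg p.degree).eq_or_lt with h0 | h0
  · simp [massDist, hd, ← h0]
  have hpos : (0 : ℝ) < c * p.degree := mul_pos (NNReal.coe_pos.2 hc) h0
  rw [massDist, massDist, hd, NNReal.coe_mul, mul_assoc,
    barycenter_eq (p := c • p) (x := barycenter p) hpos (by rw [hd, NNReal.coe_mul]),
    barycenter_eq (p := c • q) (x := barycenter q) hpos (by rw [hd, NNReal.coe_mul, h])]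
  · rw [barycenterHom_smul hc, barycenterHom_eq, scaleHom_weighted, h]
  · rw [barycenterHom_smul hc, barycenterHom_eq, scaleHom_weighted]

/-- The positive part of `f`, plus the mass of the negative part put at a base point `o`. -/
noncomputable def balancedPart {C : Type u} (o : C) (f : C →₀ ℝ) : C →₀ ℝ≥0 :=
  f.mapRange Real.toNNReal Real.toNNReal_zero +
    Finsupp.single o ((-f).mapRange Real.toNNReal Real.toNNReal_zero).degree

theorem degree_balancedPart {C : Type u} (o : C) (f : C →₀ ℝ) :
    (balancedPart o f).degree = (balancedPart o (-f)).degree := by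
  simp [balancedPart, Finsupp.degree_single, add_comm]

/-- The inclusion of nonnegative into real weights. -/
noncomputable def coeHom {C : Type u} : (C →₀ ℝ≥0) →+ (C →₀ ℝ) :=
  Finsupp.mapRange.addMonoidHom NNReal.toRealHom.toAddMonoidHom

theorem coeHom_single {C : Type u} (x : C) (a : ℝ≥0) :
    coeHom (Finsupp.single x a) = Finsupp.single x (a : ℝ) := by
  simp [coeHom]

theorem coeHom_injective {C : Type u} : Function.Injective (coeHom (C := C)) :=
  Finsupp.mapRange_injective _ (map_zero _) NNReal.coe_injective

theorem degree_coeHom {C : Type u} (p : C →₀ ℝ≥0) : (coeHom p).degree = p.degree := by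
  induction p using Finsupp.induction_linear with
  | zero => simp
  | add p q hp hq => simp only [map_add, hp, hq, NNReal.coe_add]
  | single x a => simp [coeHom]

theorem coeHom_toNNReal_sub {C : Type u} (f : C →₀ ℝ) :
    coeHom (f.mapRange Real.toNNReal Real.toNNReal_zero) -
      coeHom ((-f).mapRange Real.toNNReal Real.toNNReal_zero) = f := by
  ext x
  simp only [coeHom, Finsupp.coe_sub, Pi.sub_apply, Finsupp.mapRange.addMonoidHom_apply,
    Finsupp.mapRange_apply, Finsupp.neg_apply]
  exact (max_zero_sub_eq_self (f x))

theorem coeHom_balancedPart {C : Type u} (o : C) (f : C →₀ ℝ) :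
    coeHom (balancedPart o f) - coeHom (balancedPart o (-f)) =
      f - Finsupp.single o f.degree := by
  have h := coeHom_toNNReal_sub f
  set p := f.mapRange Real.toNNReal Real.toNNReal_zero
  set q := (-f).mapRange Real.toNNReal Real.toNNReal_zero
  have hd : f.degree = p.degree - q.degree := by
    rw [← h, map_sub, degree_coeHom, degree_coeHom]
  have e1 : balancedPart o f = p + Finsupp.single o q.degree := rfl
  have e2 : balancedPart o (-f) = q + Finsupp.single o p.degree := by
    simp only [balancedPart, neg_neg]; rfl
  rw [e1, e2, hd, map_add, map_add, coeHom_single, coeHom_single, Finsupp.single_sub,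
    add_sub_add_comm, h]
  abel

/-- The norm of a formal linear combination of points of the convexifiable domain, relative to a
base point. -/
noncomputable def formalNorm (o : convexDomain S) (f : convexDomain S →₀ ℝ) : ℝ :=
  massDist (balancedPart o f) (balancedPart o (-f))

/-- Subtracting the total mass of `f` at `o` leaves a difference of equal-mass families, and any
representation of it may be used. The seminorm properties are therefore checked on convenient
representatives. -/
theorem formalNorm_eq (o : convexDomain S) {f : convexDomain S →₀ ℝ}
    {p q : convexDomain S →₀ ℝ≥0} (h : p.degree = q.degree)
    (e : coeHom p - coeHom q = f - Finsupp.single o f.degree) : formalNorm o f = massDist p q := by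
  refine massDist_congr (degree_balancedPart o f) h (coeHom_injective ?_)
  rw [← coeHom_balancedPart] at e
  rw [map_add, map_add, ← sub_eq_sub_iff_add_eq_add, e]

/-- `formalNorm` as a seminorm. -/
noncomputable def formalSeminorm (o : convexDomain S) : Seminorm ℝ (convexDomain S →₀ ℝ) :=
  Seminorm.ofSMulLE (formalNorm o)
    (by simp [formalNorm, massDist_self])
    (fun f g => by
      rw [formalNorm_eq o (p := balancedPart o f + balancedPart o g)
        (q := balancedPart o (-f) + balancedPart o (-g))]
      · exact massDist_add_le (degree_balancedPart o f) (degree_balancedPart o g)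
      · rw [map_add, map_add, degree_balancedPart o f, degree_balancedPart o g]
      · rw [map_add, map_add, add_sub_add_comm, coeHom_balancedPart, coeHom_balancedPart, map_add,
          Finsupp.single_add, add_sub_add_comm])
    (fun c f => by
      have hpos : ∀ (c : ℝ≥0) (f : convexDomain S →₀ ℝ),
          formalNorm o ((c : ℝ) • f) = c * formalNorm o f := fun c f => by
        have hc : ∀ p : convexDomain S →₀ ℝ≥0, coeHom (c • p) = (c : ℝ) • coeHom p := fun p => by
          ext x; simp [coeHom]
        rw [formalNorm_eq o (p := c • balancedPart o f) (q := c • balancedPart o (-f)),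
          massDist_smul _ _ _ (degree_balancedPart o f), formalNorm]
        · rw [degree_smul, degree_smul, degree_balancedPart o f]
        · rw [hc, hc, ← smul_sub, coeHom_balancedPart, smul_sub, Finsupp.smul_single,
            degree_smul, smul_eq_mul]
      have hneg : ∀ f, formalNorm o (-f) = formalNorm o f := fun f => by
        rw [formalNorm, neg_neg, formalNorm, massDist_comm (degree_balancedPart o f)]
      rcases le_total 0 c with h | h
      · lift c to ℝ≥0 using h
        rw [hpos]; simp
      · obtain ⟨d, hd⟩ : ∃ d : ℝ≥0, (d : ℝ) = -c := ⟨⟨-c, by linarith⟩, rfl⟩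
        rw [← hneg, ← neg_smul, ← hd, hpos, ← norm_neg, ← hd]
        simp)

theorem formalSeminorm_apply (o : convexDomain S) (f : convexDomain S →₀ ℝ) :
    formalSeminorm o f = formalNorm o f := rfl

theorem formalSeminorm_single_sub (o x y : convexDomain S) :
    formalSeminorm o (Finsupp.single x 1 - Finsupp.single y 1) = dist x y := by
  have hb : ∀ x : convexDomain S, barycenter (Finsupp.single x 1) = x := fun x =>
    barycenter_eq one_pos (by simp) (by simp [barycenterHom_single])
  rw [formalSeminorm_apply,
    formalNorm_eq o (p := Finsupp.single x 1) (q := Finsupp.single y 1)]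
  · simp [massDist, hb]
  · simp
  · simp [coeHom]

/-- Both sides of the difference are families of mass one with barycenter `z`. -/
theorem formalSeminorm_mix (o x y z : convexDomain S) {t : ℝ} (h₀ : 0 < t) (h₁ : t < 1)
    (hz : (z : S) = mix t (x : S) y) :
    formalSeminorm o (Finsupp.single z 1 -
      (t • Finsupp.single x 1 + (1 - t) • Finsupp.single y 1)) = 0 := by
  have h₁' := sub_pos.2 h₁
  lift t to ℝ≥0 using h₀.le
  obtain ⟨s, hs⟩ : ∃ s : ℝ≥0, (s : ℝ) = 1 - t := ⟨⟨1 - t, h₁'.le⟩, rfl⟩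
  have hst : t + s = 1 := by
    apply NNReal.coe_injective; push_cast; rw [hs]; ring
  rw [formalSeminorm_apply, formalNorm_eq o (p := Finsupp.single z 1)
    (q := Finsupp.single x t + Finsupp.single y s)]
  · rw [massDist, barycenter_eq (x := z) one_pos, barycenter_eq (x := z) one_pos]
    · simp
    · simp [hst]
    · rw [map_add, barycenterHom_single, barycenterHom_single, hz, weighted_mix h₀ h₁ one_pos, hs,
        mul_one, mul_one]
    · simp
    · simp [barycenterHom_single]
  · simp [hst]
  · simp [coeHom_single, hs]

end Embedding

/-! ### Existence of the embedding -/

section Existence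

/-- Every seminorm is the norm along a linear map into a Banach space. -/
theorem exists_linearMap_norm_eq {V : Type u} [AddCommGroup V] [Module ℝ V] (N : Seminorm ℝ V) :
    ∃ (E : Type u) (_ : NormedAddCommGroup E) (_ : NormedSpace ℝ E) (φ : V →ₗ[ℝ] E),
      CompleteSpace E ∧ ∀ v, ‖φ v‖ = N v := by
  let _ : SeminormedAddCommGroup V := N.toAddGroupSeminorm.toSeminormedAddCommGroup
  let _ : NormedSpace ℝ V := { norm_smul_le := fun c v => (map_smul_eq_mul N c v).le }
  -- This completion is Hausdorff: it also identifies vectors at seminorm distance zero.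
  refine ⟨UniformSpace.Completion V, inferInstance, inferInstance,
    UniformSpace.Completion.toComplL.toLinearMap, inferInstance, fun v => ?_⟩
  exact UniformSpace.Completion.norm_coe v

variable {S : Type u} [MetricSpace S] [ConvexCombSpace S]

theorem exists_isConvexEmbedding [Nonempty (convexDomain S)] :
    ∃ (E : Type u) (_ : NormedAddCommGroup E) (_ : NormedSpace ℝ E) (j : convexDomain S → E),
      CompleteSpace E ∧ IsConvexEmbedding j := by
  obtain ⟨o⟩ := ‹Nonempty (convexDomain S)›
  have : Nonempty (convexDomain S) := ⟨o⟩
  obtain ⟨E, _, _, φ, hE, hφ⟩ := exists_linearMap_norm_eq (formalSeminorm o)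
  refine ⟨E, _, _, fun x => φ (Finsupp.single x 1), hE, fun x y => ?_, fun x y t h₀ h₁ => ?_⟩
  · rw [← map_sub, hφ, formalSeminorm_single_sub]; rfl
  · refine ⟨mix_mem x.2 y.2 h₀ h₁, ?_⟩
    rw [← sub_eq_zero, ← norm_eq_zero, ← map_smul, ← map_smul, ← map_add, ← map_sub, hφ]
    exact formalSeminorm_mix o x y _ h₀ h₁ rfl

end Existence

/-! ### Properties of an arbitrary embedding -/

section Affine

variable {S : Type u} [MetricSpace S] [ConvexCombSpace S]
  {E : Type v} [NormedAddCommGroup E] [NormedSpace ℝ E] {j : convexDomain S → E}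

theorem IsConvexEmbedding.isometry_coe (hj : IsConvexEmbedding j) : Isometry j :=
  Isometry.of_dist_eq fun x y => by rw [dist_eq_norm, ← hj.isometry]; rfl

theorem isClosedEmbedding_of_isConvexEmbedding [CompleteSpace S] (hj : IsConvexEmbedding j) :
    IsClosedEmbedding j :=
  have : CompleteSpace (convexDomain S) := isClosed_convexDomain.completeSpace_coe
  hj.isometry_coe.isClosedEmbedding

theorem IsConvexEmbedding.exists_weighted_add (hj : IsConvexEmbedding j) {a b : ℝ} (ha : 0 ≤ a)
    (hb : 0 ≤ b) (x y : convexDomain S) : ∃ p : convexDomain S,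
      weighted a (x : S) + weighted b (y : S) = weighted (a + b) (p : S) ∧
        (a + b) • j p = a • j x + b • j y := by
  rcases ha.eq_or_lt with rfl | ha
  · exact ⟨y, by simp⟩
  rcases hb.eq_or_lt with rfl | hb
  · exact ⟨x, by simp⟩
  have hs := add_pos ha hb
  obtain ⟨h, e⟩ := hj.affine x y (a / (a + b)) (div_pos ha hs) ((div_lt_one hs).2 (by linarith))
  refine ⟨⟨_, h⟩, weighted_add ha hb _ _, ?_⟩
  rw [e, smul_add, smul_smul, smul_smul]
  congr 2 <;> field_simp
  ring

theorem IsConvexEmbedding.exists_sum_weighted (hj : IsConvexEmbedding j)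
    [Nonempty (convexDomain S)] {ι : Type*} (s : Finset ι) (lam : ι → ℝ) (x : ι → convexDomain S)
    (h : ∀ i ∈ s, 0 ≤ lam i) : ∃ p : convexDomain S,
      ∑ i ∈ s, weighted (lam i) (x i : S) = weighted (∑ i ∈ s, lam i) (p : S) ∧
        (∑ i ∈ s, lam i) • j p = ∑ i ∈ s, lam i • j (x i) := by
  classical
  induction s using Finset.induction_on with
  | empty => exact ⟨Classical.arbitrary _, by simp⟩
  | insert i s hi ih =>
    obtain ⟨p, hp, hp'⟩ := ih fun i hi => h i (Finset.mem_insert_of_mem hi)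
    obtain ⟨q, hq, hq'⟩ := hj.exists_weighted_add (h i (Finset.mem_insert_self i s))
      (Finset.sum_nonneg fun i hi => h i (Finset.mem_insert_of_mem hi)) (x i) p
    refine ⟨q, ?_, ?_⟩
    · rw [Finset.sum_insert hi, Finset.sum_insert hi, hp, hq]
    · rw [Finset.sum_insert hi, Finset.sum_insert hi, hq', hp']

/-- An embedding carries combinations of finite families to combinations. -/
theorem IsConvexEmbedding.exists_combOn (hj : IsConvexEmbedding j) {ι : Type*} (s : Finset ι)
    (lam : ι → ℝ) (x : ι → convexDomain S) (h₀ : ∀ i ∈ s, 0 ≤ lam i) (h₁ : ∑ i ∈ s, lam i = 1) :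
    ∃ h : combOn s lam (fun i => (x i : S)) ∈ convexDomain S,
      j ⟨_, h⟩ = ∑ i ∈ s, lam i • j (x i) := by
  have hne : Nonempty (convexDomain S) := by
    obtain ⟨i, -⟩ : s.Nonempty := Finset.nonempty_of_sum_ne_zero (h₁ ▸ one_ne_zero)
    exact ⟨x i⟩
  set t := s.filter fun i => 0 < lam i with ht
  -- Restoring the terms of weight zero is harmless where the summand vanishes with its weight.
  have hsum : ∀ {M : Type v} [AddCommMonoid M] (f : ι → M), (∀ i, lam i = 0 → f i = 0) →
      ∑ k : Fin t.card, f (t.equivFin.symm k) = ∑ i ∈ s, f i := by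
    intro M _ f hf
    rw [Equiv.sum_comp t.equivFin.symm (fun i : t => f i), Finset.sum_coe_sort t f, ht,
      Finset.sum_filter_of_ne]
    exact fun i hi hne => (h₀ i hi).lt_of_ne fun h => hne (hf i h.symm)
  have hsumR : ∑ k : Fin t.card, lam (t.equivFin.symm k) = 1 := by
    rw [Equiv.sum_comp t.equivFin.symm (fun i : t => lam i), Finset.sum_coe_sort t lam, ht,
      Finset.sum_filter_of_ne, h₁]
    exact fun i hi hne => (h₀ i hi).lt_of_ne fun h => hne h.symm
  have hpos : ∀ k : Fin t.card, 0 < lam (t.equivFin.symm k) := fun k =>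
    (Finset.mem_filter.1 (t.equivFin.symm k).2).2
  obtain ⟨p, hp, hp'⟩ := hj.exists_sum_weighted Finset.univ
    (fun k => lam (t.equivFin.symm k)) (fun k => x (t.equivFin.symm k)) fun k _ => (hpos k).le
  rw [hsumR, one_smul, hsum (fun i => lam i • j (x i)) (fun i hi => by rw [hi, zero_smul])] at hp'
  rw [sum_weighted _ _ hpos hsumR, hsumR] at hp
  have e : combOn s lam (fun i => (x i : S)) = p := weighted_injective one_pos hp
  exact ⟨e ▸ p.2, by rw [← hp']; exact congrArg j (Subtype.ext e)⟩

theorem IsConvexEmbedding.convex_range (hj : IsConvexEmbedding j) : Convex ℝ (Set.range j) := by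
  rintro _ ⟨x, rfl⟩ _ ⟨y, rfl⟩ a b ha hb hab
  obtain ⟨p, -, hp⟩ := hj.exists_weighted_add ha hb x y
  exact ⟨p, by rw [← hp, hab, one_smul]⟩

/-- The embedding into a Banach space can be chosen to be into a separable one. -/
theorem exists_isConvexEmbedding_separable [TopologicalSpace.SeparableSpace S]
    [Nonempty (convexDomain S)] :
    ∃ (E : Type u) (_ : NormedAddCommGroup E) (_ : NormedSpace ℝ E) (j : convexDomain S → E),
      CompleteSpace E ∧ TopologicalSpace.SeparableSpace E ∧ IsConvexEmbedding j := by
  obtain ⟨E, _, _, j, hE, hj⟩ := exists_isConvexEmbedding (S := S)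
  have := UniformSpace.secondCountable_of_separable S
  -- The closed span of the image is separable because K(S) is.
  set F := (Submodule.span ℝ (Set.range j)).topologicalClosure with hF
  have hF' : ∀ x, j x ∈ F := fun x =>
    Submodule.le_topologicalClosure _ (Submodule.subset_span (Set.mem_range_self x))
  have hsep : TopologicalSpace.SeparableSpace F :=
    ((TopologicalSpace.isSeparable_range hj.isometry_coe.continuous).span (R := ℝ)
      ).closure.separableSpace
  refine ⟨F, inferInstance, inferInstance, fun x => ⟨j x, hF' x⟩,
    (Submodule.isClosed_topologicalClosure _).completeSpace_coe, hsep, fun x y => ?_,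
    fun x y t h₀ h₁ => ?_⟩
  · rw [hj.isometry]; rfl
  · obtain ⟨h, e⟩ := hj.affine x y t h₀ h₁
    exact ⟨h, Subtype.ext e⟩

theorem toDomain_convexify (x : S) : toDomain (convexify x) = toDomain x :=
  Subtype.ext (convexify_of_mem (Set.mem_range_self x))

theorem lipschitzWith_toDomain : LipschitzWith 1 (toDomain : S → convexDomain S) :=
  LipschitzWith.of_dist_le_mul fun x y => by
    simpa [Subtype.dist_eq, toDomain] using dist_convexify_le x y

theorem IsConvexEmbedding.lipschitzWith_comp_toDomain (hj : IsConvexEmbedding j) :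
    LipschitzWith 1 fun x => j (toDomain x) := by
  have := hj.isometry_coe.lipschitz.comp (lipschitzWith_toDomain (S := S))
  rwa [one_mul] at this

end Affine

/-! ### Conditional expectations -/

section CondExp

variable {Ω : Type w} (G : MeasurableSpace Ω) {mΩ : MeasurableSpace Ω} (P : Measure Ω)

/-- Conditional monotone convergence to zero. -/
theorem ae_tendsto_condExp_zero_of_antitone (hG : G ≤ mΩ) [IsFiniteMeasure P] {g : ℕ → Ω → ℝ}
    (hm : ∀ n, AEStronglyMeasurable (g n) P) (h₀ : ∀ n ω, 0 ≤ g n ω)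
    (hanti : ∀ ω, Antitone fun n => g n ω) (hint : Integrable (g 0) P)
    (hlim : ∀ ω, Tendsto (fun n => g n ω) atTop (𝓝 0)) :
    ∀ᵐ ω ∂P, Tendsto (fun n => (P[g n | G]) ω) atTop (𝓝 0) := by
  have hle : ∀ n ω, ‖g n ω‖ ≤ g 0 ω := fun n ω => by
    rw [Real.norm_of_nonneg (h₀ n ω)]
    exact hanti ω (Nat.zero_le n)
  have hi : ∀ n, Integrable (g n) P := fun n => hint.mono' (hm n) (ae_of_all _ (hle n))
  -- A decreasing sequence bounded below by zero whose integrals tend to zero converges to zero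
  -- almost surely.
  refine tendsto_of_integral_tendsto_of_antitone (F := fun _ => 0)
    (fun n => integrable_condExp) (integrable_const _) ?_ ?_ ?_
  · simp_rw [integral_condExp hG]
    exact tendsto_integral_of_dominated_convergence (g 0) hm hint
      (fun n => ae_of_all _ (hle n)) (ae_of_all _ hlim)
  · have : ∀ n, P[g (n + 1) | G] ≤ᵐ[P] P[g n | G] := fun n =>
      condExp_mono (hi _) (hi _) (ae_of_all _ fun ω => hanti ω (Nat.le_succ n))
    filter_upwards [ae_all_iff.2 this] with ω hω
    exact antitone_nat_of_succ_le hω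
  · exact ae_all_iff.2 fun n => condExp_nonneg (ae_of_all _ (h₀ n))

section Nearest

variable {S : Type u} [MetricSpace S] [MeasurableSpace S] [OpensMeasurableSpace S]

theorem dist_nearestPt_le (e : ℕ → S) (x : S) {k n : ℕ} (hk : k ≤ n) :
    dist (SimpleFunc.nearestPt e n x) x ≤ dist (e k) x := by
  have := SimpleFunc.edist_nearestPt_le e x hk
  rwa [edist_dist, edist_dist, ENNReal.ofReal_le_ofReal_iff dist_nonneg] at this

theorem antitone_dist_nearestPt (e : ℕ → S) (x : S) :
    Antitone fun n => dist (SimpleFunc.nearestPt e n x) x := fun n _ hnm =>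
  dist_nearestPt_le e x ((SimpleFunc.nearestPtInd_le e n x).trans hnm)

variable [SecondCountableTopology S] {E : Type v} [NormedAddCommGroup E]

theorem integrable_comp_of_lipschitz [BorelSpace S] [IsFiniteMeasure P] {f : S → E}
    (hf : LipschitzWith 1 f) {X : Ω → S} (hX : Measurable X) {a : S}
    (ha : Integrable (fun ω => dist a (X ω)) P) : Integrable (fun ω => f (X ω)) P := by
  refine ((integrable_const ‖f a‖).add ha).mono'
    (hf.continuous.comp_aestronglyMeasurable hX.aestronglyMeasurable) (ae_of_all _ fun ω => ?_)
  have h1 := hf.dist_le_mul (X ω) a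
  rw [NNReal.coe_one, one_mul, dist_eq_norm, dist_comm] at h1
  have h2 := norm_sub_norm_le (f (X ω)) (f a)
  simp only [Pi.add_apply]
  linarith

variable [NormedSpace ℝ E] [CompleteSpace E]

/-- The error is at most the conditional expectation of the distance from `ψ n (X)` to `X`. This
distance decreases to zero, so conditional monotone convergence applies. -/
theorem ae_tendsto_condExp_nearestPt [BorelSpace S] (hG : G ≤ mΩ) [IsFiniteMeasure P] {f : S → E}
    (hf : LipschitzWith 1 f) {e : ℕ → S} (he : DenseRange e) {X : Ω → S} (hX : Measurable X)
    {a : S} (ha : Integrable (fun ω => dist a (X ω)) P) :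
    ∀ᵐ ω ∂P, Tendsto (fun n => (P[fun ω => f (SimpleFunc.nearestPt e n (X ω)) | G]) ω) atTop
      (𝓝 ((P[fun ω => f (X ω) | G]) ω)) := by
  set g : ℕ → Ω → ℝ := fun n ω => dist (SimpleFunc.nearestPt e n (X ω)) (X ω) with hg
  have hψ : ∀ n, Measurable fun ω => SimpleFunc.nearestPt e n (X ω) := fun n =>
    (SimpleFunc.nearestPt e n).measurable.comp hX
  have hgm : ∀ n, Measurable (g n) := fun n => (hψ n).dist hX
  have hb : ∀ b : S, Integrable (fun ω => dist b (X ω)) P := fun b => by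
    refine ((integrable_const (dist b a)).add ha).mono'
      (measurable_const.dist hX).aestronglyMeasurable (ae_of_all _ fun ω => ?_)
    rw [Real.norm_of_nonneg dist_nonneg]
    exact dist_triangle _ _ _
  have hg0 : Integrable (g 0) P := by simpa [hg] using hb (e 0)
  have hgi : ∀ n, Integrable (g n) P := fun n =>
    hg0.mono' (hgm n).aestronglyMeasurable (ae_of_all _ fun ω => by
      rw [Real.norm_of_nonneg dist_nonneg]
      exact antitone_dist_nearestPt e (X ω) (Nat.zero_le n))
  have hfX := integrable_comp_of_lipschitz P hf hX ha
  have hfψ : ∀ n, Integrable (fun ω => f (SimpleFunc.nearestPt e n (X ω))) P := fun n => by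
    refine integrable_comp_of_lipschitz P hf (hψ n) (a := a)
      ((ha.add (hgi n)).mono' (measurable_const.dist (hψ n)).aestronglyMeasurable
        (ae_of_all _ fun ω => ?_))
    rw [Real.norm_of_nonneg dist_nonneg]
    exact dist_triangle_right _ _ _
  have hlim := ae_tendsto_condExp_zero_of_antitone G P hG
    (fun n => (hgm n).aestronglyMeasurable) (fun _ _ => dist_nonneg)
    (fun ω => antitone_dist_nearestPt e (X ω)) hg0
    (fun ω => tendsto_iff_dist_tendsto_zero.1 (SimpleFunc.tendsto_nearestPt (he _)))
  have hbound : ∀ n, ∀ᵐ ω ∂P, ‖(P[fun ω => f (SimpleFunc.nearestPt e n (X ω)) | G]) ω -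
      (P[fun ω => f (X ω) | G]) ω‖ ≤ (P[g n | G]) ω := fun n => by
    have h1 := condExp_sub (hfψ n) hfX G
    have h2 := norm_condExp_le (m := G) (μ := P)
      ((fun ω => f (SimpleFunc.nearestPt e n (X ω))) - fun ω => f (X ω))
    have h3 : P[fun ω => ‖((fun ω => f (SimpleFunc.nearestPt e n (X ω))) -
        fun ω => f (X ω)) ω‖ | G] ≤ᵐ[P] P[g n | G] :=
      condExp_mono ((hfψ n).sub hfX).norm (hgi n) (ae_of_all _ fun ω => by
        have := hf.dist_le_mul (SimpleFunc.nearestPt e n (X ω)) (X ω)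
        rwa [NNReal.coe_one, one_mul, dist_eq_norm] at this)
    filter_upwards [h1, h2, h3] with ω h1 h2 h3
    rw [Pi.sub_apply] at h1
    rw [← h1]
    exact h2.trans h3
  filter_upwards [hlim, ae_all_iff.2 hbound] with ω h1 h2
  exact tendsto_iff_norm_sub_tendsto_zero.2 (squeeze_zero (fun _ => norm_nonneg _) h2 h1)

end Nearest

variable {S : Type u} [MetricSpace S] [MeasurableSpace S] [ConvexCombSpace S]
  {E : Type v} [NormedAddCommGroup E] [NormedSpace ℝ E] [CompleteSpace E]
  {j : convexDomain S → E}

/-- Almost surely the conditional probabilities are nonnegative weights with sum one, so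
`exists_combOn` turns the combination into a weighted sum of the `j (K x)`. Linearity identifies
this sum with the conditional expectation. -/
theorem ae_condExpSimple [OpensMeasurableSpace S] (hG : G ≤ mΩ) [IsProbabilityMeasure P]
    (hj : IsConvexEmbedding j) (X : SimpleFunc Ω S) :
    ∀ᵐ ω ∂P, ∃ h : condExpSimple G P X ω ∈ convexDomain S,
      j ⟨_, h⟩ = (P[fun ω => j (toDomain (X ω)) | G]) ω := by
  classical
  set I : S → Ω → ℝ := fun x => (X ⁻¹' {x}).indicator fun _ => (1 : ℝ) with hI
  have hIint : ∀ x, Integrable (I x) P := fun x =>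
    (integrable_const 1).indicator (X.measurableSet_preimage {x})
  have hIapp : ∀ ω x, I x ω = if X ω = x then 1 else 0 := fun ω x => by
    simp [hI, Set.indicator_apply]
  have hnn : ∀ᵐ ω ∂P, ∀ x ∈ X.range, 0 ≤ (P[I x | G]) ω :=
    (ae_ball_iff X.range.countable_toSet).2 fun x _ => condExp_nonneg (ae_of_all _ fun ω => by
      simp only [Pi.zero_apply, hIapp]; split_ifs <;> norm_num)
  have hone : ∑ x ∈ X.range, I x = fun _ => 1 := by
    ext ω
    simp [Finset.sum_apply, hIapp]
  have hsum : ∀ᵐ ω ∂P, ∑ x ∈ X.range, (P[I x | G]) ω = 1 := by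
    have := condExp_finsetSum (s := X.range) (fun x _ => hIint x) G
    rw [hone, condExp_const hG] at this
    filter_upwards [this] with ω hω
    rw [Finset.sum_apply] at hω
    exact hω.symm
  have hval : ∀ᵐ ω ∂P, (P[fun ω => j (toDomain (X ω)) | G]) ω =
      ∑ x ∈ X.range, (P[I x | G]) ω • j (toDomain x) := by
    -- Each term is an indicator followed by the continuous linear map `c ↦ c • j (K x)`, which
    -- commutes with conditional expectation.
    have hdec : (fun ω => j (toDomain (X ω))) =
        ∑ x ∈ X.range, (ContinuousLinearMap.toSpanSingleton ℝ (j (toDomain x))) ∘ I x := by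
      ext ω
      simp [Finset.sum_apply, hIapp]
    have h1 := condExp_finsetSum (μ := P) (s := X.range)
      (f := fun x => (ContinuousLinearMap.toSpanSingleton ℝ (j (toDomain x))) ∘ I x)
      (fun x _ => (ContinuousLinearMap.toSpanSingleton ℝ (j (toDomain x))).integrable_comp
        (hIint x)) G
    have h2 : ∀ᵐ ω ∂P, ∀ x ∈ X.range, (P[I x | G]) ω • j (toDomain x) =
        (P[(ContinuousLinearMap.toSpanSingleton ℝ (j (toDomain x))) ∘ I x | G]) ω :=
      (ae_ball_iff X.range.countable_toSet).2 fun x _ =>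
        (ContinuousLinearMap.toSpanSingleton ℝ (j (toDomain x))).comp_condExp_comm (hIint x)
    rw [← hdec] at h1
    filter_upwards [h1, h2] with ω h1 h2
    rw [h1, Finset.sum_apply]
    exact Finset.sum_congr rfl fun x hx => (h2 x hx).symm
  filter_upwards [hnn, hsum, hval] with ω h1 h2 h3
  rw [h3]
  exact hj.exists_combOn X.range (fun x => (P[I x | G]) ω) toDomain h1 h2

variable [SecondCountableTopology S] [BorelSpace S]

theorem IsIntegrable.convexify_comp {X : Ω → S} (hX : IsIntegrable P X) :
    IsIntegrable P fun ω => convexify (X ω) := by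
  obtain ⟨hXm, a, ha⟩ := hX
  have hm : Measurable fun ω => convexify (X ω) :=
    lipschitzWith_convexify.continuous.measurable.comp hXm
  refine ⟨hm, convexify a, ha.mono' (measurable_const.dist hm).aestronglyMeasurable
    (ae_of_all _ fun ω => ?_)⟩
  rw [Real.norm_of_nonneg dist_nonneg]
  exact dist_convexify_le a (X ω)

variable [CompleteSpace S]

/-- The images under `j` converge; closedness of the range puts the limit in the image, and the
embedding pulls convergence back to `S`. -/
theorem ae_tendsto_condExpSimple (hG : G ≤ mΩ) [IsProbabilityMeasure P]
    (hj : IsConvexEmbedding j) {e : ℕ → S} (he : DenseRange e) {X : Ω → S} (hX : Measurable X)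
    {a : S} (ha : Integrable (fun ω => dist a (X ω)) P) :
    ∀ᵐ ω ∂P, ∃ y : convexDomain S, j y = (P[fun ω => j (toDomain (X ω)) | G]) ω ∧
      Tendsto (fun n => condExpSimple G P ((SimpleFunc.nearestPt e n).comp X hX) ω) atTop
        (𝓝 (y : S)) := by
  have h1 := ae_all_iff.2 fun n =>
    ae_condExpSimple G P hG hj ((SimpleFunc.nearestPt e n).comp X hX)
  have h2 := ae_tendsto_condExp_nearestPt G P hG (f := fun x => j (toDomain x))
    hj.lipschitzWith_comp_toDomain he hX ha
  have hc := isClosedEmbedding_of_isConvexEmbedding hj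
  filter_upwards [h1, h2] with ω h1 h2
  choose h h' using h1
  have h3 : Tendsto (fun n => j ⟨_, h n⟩) atTop (𝓝 ((P[fun ω => j (toDomain (X ω)) | G]) ω)) :=
    h2.congr fun n => (h' n).symm
  obtain ⟨y, hy⟩ := hc.isClosed_range.mem_of_tendsto h3
    (Eventually.of_forall fun n => Set.mem_range_self _)
  rw [← hy] at h3
  exact ⟨y, hy, (continuous_subtype_val.tendsto y).comp
    (hc.isInducing.tendsto_nhds_iff.2 h3)⟩

theorem exists_isCondExp (hG : G ≤ mΩ) [IsProbabilityMeasure P] (hj : IsConvexEmbedding j)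
    {e : ℕ → S} (he : DenseRange e) {X : Ω → S} (hX : IsIntegrable P X) :
    ∃ Y : Ω → S, IsCondExp G P e X Y := by
  obtain ⟨hXm, a, ha⟩ := hX
  let _ : MeasurableSpace E := borel E
  have : BorelSpace E := ⟨rfl⟩
  -- `r` extends the inverse of `j` measurably to all of `E`, so that composing with the conditional
  -- expectation gives a `G`-measurable version. Its default value `a` off the image matters only on
  -- a null set.
  obtain ⟨r, hr, hrj⟩ := (isClosedEmbedding_of_isConvexEmbedding hj).measurableEmbedding
    |>.exists_measurable_extend (measurable_subtype_coe (p := (· ∈ convexDomain S)))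
      fun _ => ⟨a⟩
  refine ⟨fun ω => r ((P[fun ω => j (toDomain (X ω)) | G]) ω), hXm,
    hr.comp stronglyMeasurable_condExp.measurable, ?_⟩
  filter_upwards [ae_tendsto_condExpSimple G P hG hj he hXm ha] with ω hω
  obtain ⟨y, hy, hlim⟩ := hω
  rw [← hy]
  have hry : r (j y) = y := congrFun hrj y
  rwa [hry]

theorem IsCondExp.ae_eq (hG : G ≤ mΩ) [IsProbabilityMeasure P] (hj : IsConvexEmbedding j)
    {e : ℕ → S} (he : DenseRange e) {X Y : Ω → S} (hX : IsIntegrable P X)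
    (hY : IsCondExp G P e X Y) : ∀ᵐ ω ∂P, ∃ h : Y ω ∈ convexDomain S,
      j ⟨Y ω, h⟩ = (P[fun ω => j (toDomain (X ω)) | G]) ω := by
  obtain ⟨hXm, -, hlim⟩ := hY
  obtain ⟨-, a, ha⟩ := hX
  filter_upwards [hlim, ae_tendsto_condExpSimple G P hG hj he hXm ha] with ω h1 h2
  obtain ⟨y, hy, h2⟩ := h2
  have e := tendsto_nhds_unique h1 h2
  exact ⟨e ▸ y.2, by rw [← hy]; exact congrArg j (Subtype.ext e)⟩

end CondExp

end ConvexCombSpace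

/-! ### The theorem -/

theorem theorem4p8
    {Ω : Type w} (G : MeasurableSpace Ω) {mΩ : MeasurableSpace Ω} (hG : G ≤ mΩ)
    (P : @Measure Ω mΩ) [IsProbabilityMeasure P]
    {S : Type u} [MetricSpace S] [CompleteSpace S] [TopologicalSpace.SeparableSpace S]
    [MeasurableSpace S] [BorelSpace S] [ConvexCombSpace S]
    (e : ℕ → S) (he₀ : e 0 ∈ ConvexCombSpace.convexDomain S)
    (he : DenseRange (fun i : ℕ => e (i + 1)))
    (X : Ω → S) (hX : ConvexCombSpace.IsIntegrable P X) :
    -- the conditional expectations of `X` and of `K X` exist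
    (∃ Y : Ω → S, ConvexCombSpace.IsCondExp G P e X Y) ∧
    (∃ Z : Ω → S, ConvexCombSpace.IsCondExp G P e (fun ω => ConvexCombSpace.convexify (X ω)) Z) ∧
    -- there is an embedding `j` of `K(S)` into a separable Banach space
    (∃ (E : Type u) (_ : NormedAddCommGroup E) (_ : NormedSpace ℝ E)
        (j : ConvexCombSpace.convexDomain S → E),
      CompleteSpace E ∧ TopologicalSpace.SeparableSpace E ∧
      IsClosed (Set.range j) ∧ Convex ℝ (Set.range j) ∧ ConvexCombSpace.IsConvexEmbedding j) ∧
    -- and the identities hold for every such embedding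
    ∀ (E : Type v) [NormedAddCommGroup E] [NormedSpace ℝ E] [CompleteSpace E]
      (j : ConvexCombSpace.convexDomain S → E), ConvexCombSpace.IsConvexEmbedding j →
      Integrable (fun ω => j (ConvexCombSpace.toDomain (X ω))) P ∧
      ∀ Y Z : Ω → S, ConvexCombSpace.IsCondExp G P e X Y →
        ConvexCombSpace.IsCondExp G P e (fun ω => ConvexCombSpace.convexify (X ω)) Z →
        ∀ᵐ ω ∂P, ∃ (hY : Y ω ∈ ConvexCombSpace.convexDomain S)
          (hZ : Z ω ∈ ConvexCombSpace.convexDomain S),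
          j ⟨Y ω, hY⟩ = j ⟨Z ω, hZ⟩ ∧
          j ⟨Z ω, hZ⟩ = (P[fun ω' => j (ConvexCombSpace.toDomain (X ω')) | G]) ω := by
  have hsc := UniformSpace.secondCountable_of_separable S
  have hne : Nonempty (ConvexCombSpace.convexDomain S) := ⟨⟨e 0, he₀⟩⟩
  have hde : DenseRange e := Dense.mono (Set.range_comp_subset_range (fun i => i + 1) e) he
  have hKX := ConvexCombSpace.IsIntegrable.convexify_comp P hX
  obtain ⟨E₀, i₁, i₂, j₀, hE₀, hsep, hj₀⟩ :=
    ConvexCombSpace.exists_isConvexEmbedding_separable (S := S)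
  refine ⟨ConvexCombSpace.exists_isCondExp G P hG hj₀ hde hX,
    ConvexCombSpace.exists_isCondExp G P hG hj₀ hde hKX,
    ⟨E₀, i₁, i₂, j₀, hE₀, hsep,
      (ConvexCombSpace.isClosedEmbedding_of_isConvexEmbedding hj₀).isClosed_range,
      hj₀.convex_range, hj₀⟩, fun E _ _ _ j hj => ⟨?_, fun Y Z hY hZ => ?_⟩⟩
  · obtain ⟨hXm, a, ha⟩ := hX
    exact ConvexCombSpace.integrable_comp_of_lipschitz P hj.lipschitzWith_comp_toDomain hXm ha
  · have h1 := ConvexCombSpace.IsCondExp.ae_eq G P hG hj hde hX hY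
    have h2 := ConvexCombSpace.IsCondExp.ae_eq G P hG hj hde hKX hZ
    -- Since `K (K x) = K x`, both `Y` and `Z` correspond to the same Banach-valued conditional
    -- expectation.
    simp only [ConvexCombSpace.toDomain_convexify] at h2
    filter_upwards [h1, h2] with ω h1 h2
    obtain ⟨hY', e1⟩ := h1
    obtain ⟨hZ', e2⟩ := h2
    exact ⟨hY', hZ', e1.trans e2.symm, e2⟩
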